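/- Let $u:\mathbf{C}\to[-\infty,\infty)$ be a subharmonic function on the complex plane (upper semicontinuous, with $u(z)\le\frac1{2\pi}\int_0^{2\pi}u(z+re^{i\theta})\,d\theta$ for all $z\in\mathbf{C}$, $r>0$) which is a ridge function, that is, $u(z)\le u(i\,\mathrm{Im}\,z)$ for all $z\in\mathbf{C}$, and let $\Delta>0$. Suppose that $$\liminf_{r\to+\infty}\frac{\log\max\{u(ir),u(-ir)\}}{r}=0$$ (with $\log t=-\infty$ for $t\le 0$), that $u$ is harmonic (in particular finite) in the vertical strip $\{z:|\mathrm{Re}\,z|<\Delta\}$, and that $u$ is normalized by $u(0)=u_x(0)=u_y(0)=0$ and $u_{yy}(0)=1$, where $z=x+iy$. Then $$\left|u(z)+\mathrm{Re}\,(z^2/2)\right|\le c_0\,\frac{|z|^3}{\Delta}\qquad\text{for all } |z|\le\Delta/3,$$ where $c_0>0$ is an absolute constant, that is, it depends neither on $u$ nor on $\Delta$. -/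

import Mathlib

open Set Filter Topology MeasureTheory
open scoped ENNReal

/-- The mean value of `u : ℂ → [-∞, ∞]` over the circle with centre `c` and radius `r`, taken with
respect to normalized arc length: the mean of the positive part minus the mean of the negative
part. If `u` is bounded above on the circle then the first term is finite, and the value is the
integral in the extended sense, which is `-∞` exactly when the negative part is not integrable. -/
noncomputable def circleMean (u : ℂ → EReal) (c : ℂ) (r : ℝ) : EReal :=
  ((⨍⁻ θ in Ioc (0 : ℝ) (2 * Real.pi), (u (circleMap c r θ)).toENNReal ∂volume : ℝ≥0∞) : EReal) -
    ((⨍⁻ θ in Ioc (0 : ℝ) (2 * Real.pi), (-u (circleMap c r θ)).toENNReal ∂volume : ℝ≥0∞) : EReal)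

/-- Subharmonic functions `u : ℂ → [-∞, ∞)` on the whole plane: upper semicontinuous functions
with the sub-mean value property. -/
structure IsSubharmonic (u : ℂ → EReal) : Prop where
  ne_top : ∀ z, u z ≠ ⊤
  upperSemicontinuous : UpperSemicontinuous u
  le_circleMean : ∀ (z : ℂ) (r : ℝ), 0 < r → u z ≤ circleMean u z r

/-- `u` is a ridge function: `u z ≤ u (i Im z)` for all `z`. -/
def IsRidge (u : ℂ → EReal) : Prop :=
  ∀ z : ℂ, u z ≤ u (z.im * Complex.I)

/-- The open vertical strip `|Re z| < Δ`. -/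
def verticalStrip (Δ : ℝ) : Set ℂ := {z | |z.re| < Δ}

/-- The extended-real valued function `u` is finite and harmonic on `S`. -/
def IsHarmonicOn (u : ℂ → EReal) (S : Set ℂ) : Prop :=
  (∀ z ∈ S, u z ≠ ⊥ ∧ u z ≠ ⊤) ∧
    InnerProductSpace.HarmonicOnNhd (fun z => (u z).toReal) S

/-- `liminf_{r → ∞} log (max {u(ir), u(-ir)}) / r = 0`, as an identity in `[-∞, ∞]`, where the
logarithm of a number `≤ 0` is read as `-∞`. -/
def HasSlowGrowth (u : ℂ → EReal) : Prop :=
  liminf (fun r : ℝ =>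
    ENNReal.log (max (u (r * Complex.I)) (u (-(r * Complex.I)))).toENNReal / (r : EReal))
    atTop = 0

/-! Write `U` for the real-valued function and `g = U_x - i U_y` for its holomorphic gradient. The
heart of the matter is that `U` decreases away from the imaginary axis when `|x| < Δ/2`, that is, `x
* U_x ≤ 0` there.

This is a moving-plane argument (`reflect_le`). For `0 < a < Δ/2`, subtract `U` from its mirror
image in `Re z = a`. The difference is `≤ 0` on the imaginary axis, by the ridge property, and `0`
on `Re z = a`. A Phragmén–Lindelöf argument makes it `≤ 0` in between. The growth control it needs
comes from two facts: `U` is convex on the axis, so a bound at `±iR` holds at all lower heights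
(`axis_le_max`), and Borel–Carathéodory turns upper bounds into lower ones (`neg_le`).

Now `F = -g` satisfies `F 0 = 0`, `F' 0 = 1` and `Re F * Re z ≥ 0`. Such functions obey `|F z - z| =
O(|z|² / Δ)` (`norm_sub_le_of_re_mul_re_nonneg`); integrating along the segment from `0` to `z`
gives the cubic error. -/

open InnerProductSpace in
/-- Weak maximum principle for harmonic functions in the plane. -/
theorem harmonic_nonpos_of_nonpos_off_open {K V : Set ℂ} {f : ℂ → ℝ} (hK : IsCompact K)
    (hV : IsOpen V) (hVK : V ⊆ K) (hc : ContinuousOn f K) (hf : HarmonicOnNhd f V)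
    (hb : ∀ z ∈ K \ V, f z ≤ 0) {z : ℂ} (hz : z ∈ K) : f z ≤ 0 := by
  by_contra! hpos
  obtain ⟨p, hpK, hp⟩ := hK.exists_isMaxOn ⟨z, hz⟩ hc
  have hMpos : 0 < f p := hpos.trans_le (hp hz)
  -- Among all maximum points take the rightmost, `q`. If it lay in `V`, then `|exp F|`, where `Re F
  -- = f`, would be locally constant at `q`, and a step to the right would give another maximum
  -- point.
  have hAc : IsCompact (K ∩ f ⁻¹' {f p}) :=
    hK.of_isClosed_subset (hc.preimage_isClosed_of_isClosed hK.isClosed isClosed_singleton)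
      inter_subset_left
  obtain ⟨q, ⟨hqK, hqf⟩, hq⟩ :=
    hAc.exists_isMaxOn ⟨p, hpK, rfl⟩ Complex.continuous_re.continuousOn
  have hqf : f q = f p := hqf
  have hqV : q ∈ V := by
    by_contra h
    have := hb q ⟨hqK, h⟩
    linarith
  obtain ⟨r, hr, hrV⟩ := Metric.isOpen_iff.1 hV q hqV
  obtain ⟨F, hF, hFf⟩ := (hf.mono hrV).exists_analyticOnNhd_ball_re_eq
  have hball : Metric.ball q r ∈ 𝓝 q := Metric.ball_mem_nhds q hr
  have hd : ∀ᶠ w in 𝓝 q, DifferentiableAt ℂ (fun w => Complex.exp (F w)) w := by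
    filter_upwards [hball] with w hw
    exact (hF w hw).differentiableAt.cexp
  have hmax : IsLocalMax (norm ∘ fun w => Complex.exp (F w)) q := by
    filter_upwards [hball] with w hw
    have h1 := hFf hw
    have h2 := hFf (Metric.mem_ball_self hr : q ∈ Metric.ball q r)
    simp only at h1 h2
    simp only [Function.comp, Complex.norm_exp, Real.exp_le_exp, h1, h2, hqf]
    exact hp (hVK (hrV hw))
  have hev := Complex.eventually_eq_of_isLocalMax_norm hd hmax
  obtain ⟨s, hs, hsq⟩ := Metric.eventually_nhds_iff_ball.1 (hev.and hball)
  have hw : q + ((s / 2 : ℝ) : ℂ) ∈ Metric.ball q s := by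
    simp [abs_of_pos hs]; linarith
  obtain ⟨h1, h2⟩ := hsq _ hw
  have h3 := congrArg norm h1
  have h4 := hFf h2
  have h5 := hFf (Metric.mem_ball_self hr : q ∈ Metric.ball q r)
  simp only at h4 h5
  rw [Complex.norm_exp, Complex.norm_exp, Real.exp_eq_exp, h4, h5, hqf] at h3
  have := hq ⟨hVK (hrV h2), h3⟩
  simp at this
  linarith

/-- Harmonicity is preserved by reflection in a vertical line. -/
theorem HarmonicAt.comp_const_sub_conj {f : ℂ → ℝ} {c z : ℂ}
    (hf : InnerProductSpace.HarmonicAt f (c - starRingEnd ℂ z)) :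
    InnerProductSpace.HarmonicAt (fun w => f (c - starRingEnd ℂ w)) z := by
  obtain ⟨r, hr, hrV⟩ := Metric.eventually_nhds_iff_ball.1 hf.eventually
  obtain ⟨F, hF, hFf⟩ :=
    InnerProductSpace.HarmonicOnNhd.exists_analyticOnNhd_ball_re_eq (f := f) hrV
  set φ : ℂ → ℂ := fun w => starRingEnd ℂ (F (c - starRingEnd ℂ w)) with hφ
  have hmem : ∀ᶠ w in 𝓝 z, c - starRingEnd ℂ w ∈ Metric.ball (c - starRingEnd ℂ z) r := by
    have hcont : Continuous fun w : ℂ => c - starRingEnd ℂ w := by fun_prop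
    exact hcont.continuousAt.preimage_mem_nhds (Metric.ball_mem_nhds _ hr)
  have hdiff : ∀ᶠ w in 𝓝 z, DifferentiableAt ℂ φ w := by
    filter_upwards [hmem] with w hw
    have h1 : DifferentiableAt ℂ (fun v => F (c - v)) (starRingEnd ℂ w) :=
      DifferentiableAt.comp (starRingEnd ℂ w) (hF _ hw).differentiableAt (by fun_prop)
    have := h1.conj_conj
    simpa [hφ, Function.comp_def] using this
  have hA : AnalyticAt ℂ φ z := Complex.analyticAt_iff_eventually_differentiableAt.2 hdiff
  refine (InnerProductSpace.harmonicAt_congr_nhds ?_).1 hA.harmonicAt_re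
  filter_upwards [hmem] with w hw
  simpa [hφ] using hFf hw

/-! ### The holomorphic gradient and derivatives along lines -/

/-- The holomorphic function `∂f/∂x - i ∂f/∂y`. -/
noncomputable def complexPartial (f : ℂ → ℝ) (z : ℂ) : ℂ :=
  fderiv ℝ f z 1 - Complex.I * fderiv ℝ f z Complex.I

theorem complexPartial_mul_re (f : ℂ → ℝ) (z w : ℂ) :
    (complexPartial f z * w).re = fderiv ℝ f z w := by
  have hw : w = w.re • (1 : ℂ) + w.im • Complex.I := by
    simp [Complex.re_add_im]
  conv_rhs => rw [hw]
  rw [map_add, map_smul, map_smul]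
  simp [complexPartial]
  ring

theorem HarmonicAt.analyticAt_complexPartial {f : ℂ → ℝ} {z : ℂ}
    (hf : InnerProductSpace.HarmonicAt f z) : AnalyticAt ℂ (complexPartial f) z :=
  _root_.HarmonicAt.analyticAt_complex_partial hf

theorem hasDerivAt_affine (p w : ℂ) (t : ℝ) : HasDerivAt (fun s : ℝ => p + s * w) w t := by
  simpa using ((Complex.ofRealCLM.hasDerivAt (x := t)).mul_const w).const_add p

theorem HarmonicAt.hasDerivAt_line {f : ℂ → ℝ} {p w : ℂ} {t : ℝ}
    (hf : InnerProductSpace.HarmonicAt f (p + t * w)) :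
    HasDerivAt (fun s : ℝ => f (p + s * w)) (complexPartial f (p + t * w) * w).re t := by
  rw [complexPartial_mul_re]
  exact (hf.1.differentiableAt (by norm_num)).hasFDerivAt.comp_hasDerivAt t
    (hasDerivAt_affine p w t)

theorem HarmonicAt.hasDerivAt_complexPartial_line {f : ℂ → ℝ} {p w : ℂ} {t : ℝ}
    (hf : InnerProductSpace.HarmonicAt f (p + t * w)) :
    HasDerivAt (fun s : ℝ => (complexPartial f (p + s * w) * w).re)
      (deriv (complexPartial f) (p + t * w) * w * w).re t := by
  have h1 := (HarmonicAt.analyticAt_complexPartial hf).differentiableAt.hasDerivAt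
  have h2 : HasDerivAt (fun s : ℝ => complexPartial f (p + s * w))
      (deriv (complexPartial f) (p + t * w) * w) t := by
    have := h1.scomp t (hasDerivAt_affine p w t)
    simpa [Function.comp_def, mul_comm] using this
  exact (Complex.reCLM.hasFDerivAt.comp_hasDerivAt t (h2.mul_const w))

/-- At a local maximum the second derivative is nonpositive. -/
theorem IsLocalMax.deriv_deriv_nonpos {h : ℝ → ℝ} {t : ℝ} (hm : IsLocalMax h t)
    (hc : ContinuousAt h t) : deriv (deriv h) t ≤ 0 := by
  by_contra! hpos
  have hmin := isLocalMin_of_deriv_deriv_pos hpos hm.deriv_eq_zero hc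
  have hconst : h =ᶠ[𝓝 t] fun _ => h t := by
    filter_upwards [hm, hmin] with s h1 h2 using le_antisymm h1 h2
  have := hconst.deriv.deriv_eq
  simp at this
  linarith

theorem isOpen_verticalStrip (Δ : ℝ) : IsOpen (verticalStrip Δ) :=
  isOpen_lt (by fun_prop) continuous_const

/-! ### Ridge functions on the axis: convexity and lower bounds -/

/-- A real-valued harmonic ridge function in the strip `|Re z| < Δ`. -/
structure IsStripRidge (U : ℂ → ℝ) (Δ : ℝ) : Prop where
  pos : 0 < Δ
  harmonic : InnerProductSpace.HarmonicOnNhd U (verticalStrip Δ)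
  ridge : ∀ z ∈ verticalStrip Δ, U z ≤ U (z.im * Complex.I)

namespace IsStripRidge

variable {U : ℂ → ℝ} {Δ : ℝ}

theorem mem_axis (h : IsStripRidge U Δ) (y : ℝ) : (y : ℂ) * Complex.I ∈ verticalStrip Δ := by
  simp [verticalStrip, h.pos]

theorem harmonicAt_axis (h : IsStripRidge U Δ) (y : ℝ) :
    InnerProductSpace.HarmonicAt U (y * Complex.I) := h.harmonic _ (h.mem_axis y)

theorem isLocalMax_horizontal (h : IsStripRidge U Δ) (y : ℝ) :
    IsLocalMax (fun s : ℝ => U (y * Complex.I + s * 1)) 0 := by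
  have : ∀ᶠ s : ℝ in 𝓝 0, |s| < Δ := by
    have := h.pos
    exact (continuous_abs.tendsto' 0 0 (by simp)).eventually_lt_const this
  filter_upwards [this] with s hs
  simpa using h.ridge (y * Complex.I + s * 1) (by simpa [verticalStrip] using hs)

theorem complexPartial_axis_re (h : IsStripRidge U Δ) (y : ℝ) :
    (complexPartial U (y * Complex.I)).re = 0 := by
  have h1 := HarmonicAt.hasDerivAt_line (f := U) (p := y * Complex.I) (w := 1) (t := 0)
    (by simpa using h.harmonicAt_axis y)
  have := (h.isLocalMax_horizontal y).hasDerivAt_eq_zero h1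
  simpa using this

theorem hasDerivAt_axis (h : IsStripRidge U Δ) (y : ℝ) :
    HasDerivAt (fun s : ℝ => U (s * Complex.I))
      (-(complexPartial U (y * Complex.I)).im) y := by
  simpa using HarmonicAt.hasDerivAt_line (f := U) (p := 0) (w := Complex.I) (t := y)
    (by simpa using h.harmonicAt_axis y)

theorem hasDerivAt_complexPartial_axis (h : IsStripRidge U Δ) (y : ℝ) :
    HasDerivAt (fun s : ℝ => -(complexPartial U (s * Complex.I)).im)
      (-(deriv (complexPartial U) (y * Complex.I)).re) y := by
  simpa [mul_assoc] using HarmonicAt.hasDerivAt_complexPartial_line (f := U) (p := 0)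
    (w := Complex.I) (t := y) (by simpa using h.harmonicAt_axis y)

theorem deriv_complexPartial_axis_re_nonpos (h : IsStripRidge U Δ) (y : ℝ) :
    (deriv (complexPartial U) (y * Complex.I)).re ≤ 0 := by
  have hev : ∀ᶠ s : ℝ in 𝓝 0, InnerProductSpace.HarmonicAt U (y * Complex.I + s * 1) := by
    have hc : Continuous fun s : ℝ => (y * Complex.I + s * 1 : ℂ) := by fun_prop
    have := (h.harmonicAt_axis y).eventually
    exact (hc.tendsto' 0 (y * Complex.I) (by simp)).eventually this
  have h0 : InnerProductSpace.HarmonicAt U (y * Complex.I + (0 : ℝ) * 1) := hev.self_of_nhds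
  have hd : deriv (fun s : ℝ => U (y * Complex.I + s * 1)) =ᶠ[𝓝 0]
      fun s : ℝ => (complexPartial U (y * Complex.I + s * 1) * 1).re := by
    filter_upwards [hev] with s hs using (HarmonicAt.hasDerivAt_line hs).deriv
  have := (h.isLocalMax_horizontal y).deriv_deriv_nonpos
    (HarmonicAt.hasDerivAt_line h0).continuousAt
  rw [hd.deriv_eq, (HarmonicAt.hasDerivAt_complexPartial_line h0).deriv] at this
  simpa using this

/-- The real part `U_x` of the gradient vanishes along the axis, hence so does its derivative in the
direction `i`. -/
theorem deriv_complexPartial_zero_im (h : IsStripRidge U Δ) :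
    (deriv (complexPartial U) 0).im = 0 := by
  have h1 := (HarmonicAt.analyticAt_complexPartial
    (h.harmonicAt_axis 0)).differentiableAt.hasDerivAt
  have h2 : HasDerivAt (fun s : ℝ => complexPartial U (s * Complex.I))
      (deriv (complexPartial U) 0 * Complex.I) 0 := by
    have := h1.scomp (0 : ℝ) (by simpa using hasDerivAt_affine 0 Complex.I 0)
    simpa [Function.comp_def, mul_comm] using this
  have h3 := Complex.reCLM.hasFDerivAt.comp_hasDerivAt 0 h2
  have h4 : (fun s : ℝ => (complexPartial U (s * Complex.I)).re) = fun _ => 0 :=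
    funext h.complexPartial_axis_re
  have h5 : HasDerivAt (fun s : ℝ => (complexPartial U (s * Complex.I)).re)
      (deriv (complexPartial U) 0 * Complex.I).re 0 := h3
  rw [h4] at h5
  simpa using h5.unique (hasDerivAt_const _ _)

/-- Each axis point is a horizontal maximum, so `U_xx ≤ 0` there, and harmonicity gives `U_yy =
-U_xx ≥ 0`. -/
theorem convexOn_axis (h : IsStripRidge U Δ) :
    ConvexOn ℝ univ (fun s : ℝ => U (s * Complex.I)) := by
  have hd : deriv (fun s : ℝ => U (s * Complex.I)) =
      fun s : ℝ => -(complexPartial U (s * Complex.I)).im :=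
    funext fun y => (h.hasDerivAt_axis y).deriv
  refine convexOn_univ_of_deriv2_nonneg (fun y => (h.hasDerivAt_axis y).differentiableAt) ?_ ?_
  · rw [hd]
    exact fun y => (h.hasDerivAt_complexPartial_axis y).differentiableAt
  · intro y
    simp only [Function.iterate_succ, Function.iterate_zero, Function.comp, id]
    rw [hd, (h.hasDerivAt_complexPartial_axis y).deriv]
    linarith [h.deriv_complexPartial_axis_re_nonpos y]

theorem axis_nonneg (h : IsStripRidge U Δ) (h0 : U 0 = 0) (h1 : complexPartial U 0 = 0)
    (y : ℝ) : 0 ≤ U (y * Complex.I) := by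
  have hd := h.hasDerivAt_axis 0
  simp only [Complex.ofReal_zero, zero_mul, h1, Complex.zero_im, neg_zero] at hd
  have hmin : IsMinOn (fun s : ℝ => U (s * Complex.I)) univ 0 :=
    h.convexOn_axis.isMinOn_of_rightDeriv_eq_zero (by simp) 
      (hd.hasDerivWithinAt.derivWithin (uniqueDiffWithinAt_Ioi 0))
  simpa [h0] using hmin (mem_univ y)

/-- Growth is controlled only along a sequence of radii; this transfers the control to all smaller
heights. -/
theorem axis_le_max (h : IsStripRidge U Δ) {y r : ℝ} (hy : |y| ≤ r) :
    U (y * Complex.I) ≤ max (U (r * Complex.I)) (U (-(r * Complex.I))) := by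
  have hseg : y ∈ segment ℝ (-r) r := by
    rw [segment_eq_Icc (by linarith [abs_nonneg y])]
    exact abs_le.1 hy
  have := h.convexOn_axis.le_on_segment (mem_univ (-r)) (mem_univ r) hseg
  simpa [max_comm] using this

/-- A lower bound for the function near the axis, by the Borel-Carathéodory theorem. -/
theorem neg_le (h : IsStripRidge U Δ) {M Y x : ℝ} (hM : 0 < M) (hY : 0 ≤ U (Y * Complex.I))
    (hb : ∀ y, |y - Y| ≤ Δ → U (y * Complex.I) ≤ M) (hx : |x| ≤ Δ / 2) :
    -(2 * M) ≤ U (Y * Complex.I + x) := by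
  have hΔ := h.pos
  set p : ℂ := Y * Complex.I with hp
  have hball : Metric.ball p Δ ⊆ verticalStrip Δ := by
    intro z hz
    have h1 : ‖z - p‖ < Δ := by simpa [dist_eq_norm] using hz
    have h2 := Complex.abs_re_le_norm (z - p)
    have h3 : (z - p).re = z.re := by simp [hp]
    rw [h3] at h2
    exact h2.trans_lt h1
  obtain ⟨F, hF, hFU⟩ := (h.harmonic.mono hball).exists_analyticOnNhd_ball_re_eq
  have hFp : (F p).re = U p := hFU (Metric.mem_ball_self hΔ)
  have hin : ∀ z ∈ Metric.ball (0 : ℂ) Δ, p + z ∈ Metric.ball p Δ := by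
    intro z hz
    simpa [dist_eq_norm] using hz
  have hx' : (x : ℂ) ∈ Metric.ball (0 : ℂ) Δ := by
    simp; linarith
  have hdiff : DifferentiableOn ℂ (fun z => F (p + z) - F p) (Metric.ball 0 Δ) := by
    intro z hz
    have : DifferentiableAt ℂ (fun z => F (p + z)) z :=
      DifferentiableAt.comp z (hF _ (hin z hz)).differentiableAt (by fun_prop)
    exact (this.sub_const _).differentiableWithinAt
  -- The real part is `U (p + z) - U p`; the ridge property bounds the first term by `M`, and `U p ≥
  -- 0`.
  have hmaps : MapsTo (fun z => F (p + z) - F p) (Metric.ball 0 Δ) {z | z.re ≤ M} := by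
    intro z hz
    have h1 : (F (p + z)).re = U (p + z) := hFU (hin z hz)
    have h2 := h.ridge _ (hball (hin z hz))
    have hz' : ‖z‖ < Δ := by simpa using hz
    have h3 := hb (p + z).im (by
      have := Complex.abs_im_le_norm z
      simp [hp]; linarith)
    simp only [Set.mem_ofPred_eq, Complex.sub_re]
    rw [h1, hFp]
    linarith
  have hbc := Complex.borelCaratheodory_zero hM hdiff hmaps hΔ hx' (by simp)
  have h4 : 2 * M * ‖(x : ℂ)‖ / (Δ - ‖(x : ℂ)‖) ≤ 2 * M := by
    simp only [Complex.norm_real, Real.norm_eq_abs]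
    rw [div_le_iff₀ (by linarith)]
    nlinarith
  have h5 := (Complex.abs_re_le_norm _).trans (hbc.trans h4)
  have h6 : (F (p + x)).re = U (p + x) := hFU (hin _ hx')
  rw [Complex.sub_re, h6, hFp] at h5
  have := (abs_le.1 h5).1
  linarith

end IsStripRidge

/-! ### Slow growth and auxiliary estimates -/

theorem HasSlowGrowth.frequently_le_exp {u : ℂ → EReal} (h : HasSlowGrowth u)
    (hb : ∀ y : ℝ, u (y * Complex.I) ≠ ⊤) {ε : ℝ} (hε : 0 < ε) :
    ∃ᶠ r : ℝ in atTop, (u (r * Complex.I)).toReal ≤ Real.exp (ε * r) ∧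
      (u (-(r * Complex.I))).toReal ≤ Real.exp (ε * r) := by
  have h1 : ∃ᶠ r : ℝ in atTop,
      ENNReal.log (max (u (r * Complex.I)) (u (-(r * Complex.I)))).toENNReal / (r : EReal)
        < (ε : EReal) := by
    refine frequently_lt_of_liminf_lt ?_ ?_
    · isBoundedDefault
    · rw [HasSlowGrowth] at h
      rw [h]
      exact_mod_cast hε
  refine (h1.and_eventually (eventually_gt_atTop 0)).mono ?_
  rintro r ⟨hr, hr0⟩
  have h2 : ENNReal.log (max (u (r * Complex.I)) (u (-(r * Complex.I)))).toENNReal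
      ≤ ((ε * r : ℝ) : EReal) := by
    rw [EReal.coe_mul]
    exact (EReal.div_le_iff_le_mul (by exact_mod_cast hr0) (EReal.coe_ne_top r)).1 hr.le |>.trans_eq
      (mul_comm _ _)
  have h3 : (max (u (r * Complex.I)) (u (-(r * Complex.I)))).toENNReal
      ≤ ENNReal.ofReal (Real.exp (ε * r)) := by
    have := EReal.exp_monotone h2
    rwa [ENNReal.exp_log, EReal.exp_coe] at this
  have h4 : ∀ x : EReal, x ≠ ⊤ → x ≤ max (u (r * Complex.I)) (u (-(r * Complex.I))) →
      x.toReal ≤ Real.exp (ε * r) := by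
    intro x hx hle
    have h5 := (EReal.toENNReal_le_toENNReal hle).trans h3
    rw [EReal.toENNReal_of_ne_top hx] at h5
    exact (ENNReal.ofReal_le_ofReal_iff (Real.exp_pos _).le).1 h5
  exact ⟨h4 _ (hb r) (le_max_left _ _), h4 _ (by simpa using hb (-r)) (le_max_right _ _)⟩

/-- A function growing along the imaginary axis more slowly than every exponential, along some
sequence of radii. -/
def SlowOnAxis (U : ℂ → ℝ) : Prop :=
  ∀ ε : ℝ, 0 < ε → ∃ᶠ r : ℝ in atTop,
    U (r * Complex.I) ≤ Real.exp (ε * r) ∧ U (-(r * Complex.I)) ≤ Real.exp (ε * r)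

theorem re_cos_mul_sub (b x y : ℝ) (c : ℝ) :
    (Complex.cos (b * ((x + y * Complex.I) - c))).re
      = Real.cos (b * (x - c)) * Real.cosh (b * y) := by
  have : (b * ((x + y * Complex.I) - c) : ℂ)
      = ((b * (x - c) : ℝ) : ℂ) + ((b * y : ℝ) : ℂ) * Complex.I := by
    push_cast; ring
  rw [this, Complex.cos_add_mul_I, ← Complex.ofReal_cos, ← Complex.ofReal_cosh,
    ← Complex.ofReal_sin, ← Complex.ofReal_sinh, Complex.sub_re, ← Complex.ofReal_mul,
    ← Complex.ofReal_mul, Complex.ofReal_re, Complex.re_ofReal_mul]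
  simp

theorem Real.half_le_cos {t : ℝ} (ht : |t| ≤ 1 / 2) : 1 / 2 ≤ Real.cos t := by
  have h1 := Real.one_sub_sq_div_two_le_cos (x := t)
  have h2 : t ^ 2 ≤ (1 / 2) ^ 2 := sq_le_sq' (by linarith [(abs_le.1 ht).1]) (abs_le.1 ht).2
  linarith

/-- The derivative is nonpositive at a point if the function decreases under reflection. -/
theorem HasDerivAt.nonpos_of_le_neg {φ : ℝ → ℝ} {d r : ℝ} (hd : HasDerivAt φ d 0)
    (hr : 0 < r) (hφ : ∀ t, 0 < t → t < r → φ t ≤ φ (-t)) : d ≤ 0 := by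
  have h1 : HasDerivAt (fun t => φ t - φ (-t)) (d - d * (-1)) 0 := by
    refine hd.sub (HasDerivAt.comp (0 : ℝ) (by simpa using hd) (hasDerivAt_neg 0))
  have h2 := (hasDerivAt_iff_tendsto_slope.1 h1).mono_left (nhdsGT_le_nhdsNE 0)
  have h3 : d - d * (-1) ≤ 0 := by
    refine le_of_tendsto h2 ?_
    filter_upwards [Ioo_mem_nhdsGT hr] with t ht
    rw [slope_def_field]
    refine div_nonpos_of_nonpos_of_nonneg ?_ (by linarith [ht.1])
    have := hφ t ht.1 ht.2
    simp
    linarith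
  linarith

/-! ### Reflection in vertical lines and the sign of the horizontal derivative -/

namespace IsStripRidge

variable {U : ℂ → ℝ} {Δ : ℝ}

/-- Comparison of the values at two points symmetric with respect to a vertical line. -/
theorem reflect_le (h : IsStripRidge U Δ) (h0 : U 0 = 0) (h1 : complexPartial U 0 = 0)
    (hs : SlowOnAxis U) {a : ℝ} (ha : 0 < a) (haΔ : a < Δ / 2) {z : ℂ} (hz0 : 0 ≤ z.re)
    (hza : z.re ≤ a) : U (2 * a - starRingEnd ℂ z) ≤ U z := by
  have hΔ := h.pos
  -- Barrier: for `0 ≤ Re w ≤ a` the cosine argument stays in `[-1/2, 1/2]`, so `H` is positive and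
  -- grows like `exp (|Im w| / a)`, beating the rate `1 / (2a)` allowed to `U`.
  set H : ℂ → ℝ := fun w => (Complex.cos (((a⁻¹ : ℝ) : ℂ) * (w - ((a / 2 : ℝ) : ℂ)))).re with hH
  have hHeq : ∀ w : ℂ, H w = Real.cos (a⁻¹ * (w.re - a / 2)) * Real.cosh (a⁻¹ * w.im) := by
    intro w
    have := re_cos_mul_sub a⁻¹ w.re w.im (a / 2)
    rwa [Complex.re_add_im] at this
  have hcos : ∀ x, 0 ≤ x → x ≤ a → 1 / 2 ≤ Real.cos (a⁻¹ * (x - a / 2)) := by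
    intro x hx hxa
    apply Real.half_le_cos
    rw [abs_mul, abs_of_pos (inv_pos.2 ha), inv_mul_le_iff₀ ha, abs_le]
    constructor <;> linarith
  have hHlow : ∀ w : ℂ, 0 ≤ w.re → w.re ≤ a → Real.exp (a⁻¹ * |w.im|) / 4 ≤ H w := by
    intro w hw hwa
    rw [hHeq, ← Real.cosh_abs, abs_mul, abs_of_pos (inv_pos.2 ha)]
    have h2 := hcos _ hw hwa
    have h3 : Real.exp (a⁻¹ * |w.im|) / 2 ≤ Real.cosh (a⁻¹ * |w.im|) := by
      rw [Real.cosh_eq]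
      have := (Real.exp_pos (-(a⁻¹ * |w.im|))).le
      linarith
    have h4 := Real.exp_pos (a⁻¹ * |w.im|)
    nlinarith
  have hHpos : ∀ w : ℂ, 0 ≤ w.re → w.re ≤ a → 0 ≤ H w := fun w hw hwa =>
    le_trans (by positivity) (hHlow w hw hwa)
  have key : ∀ δ : ℝ, 0 < δ → U (2 * a - starRingEnd ℂ z) - U z ≤ δ * H z := by
    intro δ hδ
    -- With `M = exp (R / (2a))`, the difference on the horizontal edges is at most `M + 2M`: the
    -- upper bound on the axis and the lower bound from `neg_le`.
    have hlarge : ∀ᶠ R : ℝ in atTop, 3 * Real.exp (a⁻¹ / 2 * R)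
        ≤ δ * (Real.exp (a⁻¹ * (R - Δ)) / 4) := by
      have ht : Tendsto (fun R : ℝ => Real.exp (a⁻¹ / 2 * R)) atTop atTop :=
        Real.tendsto_exp_atTop.comp (tendsto_id.const_mul_atTop (by positivity))
      filter_upwards [ht.eventually_ge_atTop (12 * Real.exp (a⁻¹ * Δ) / δ)] with R hR
      have e1 : Real.exp (a⁻¹ * (R - Δ)) * Real.exp (a⁻¹ * Δ)
          = Real.exp (a⁻¹ / 2 * R) * Real.exp (a⁻¹ / 2 * R) := by
        rw [← Real.exp_add, ← Real.exp_add]; ring_nf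
      rw [div_le_iff₀ hδ] at hR
      have p1 := Real.exp_pos (a⁻¹ * Δ)
      have p2 := Real.exp_pos (a⁻¹ / 2 * R)
      refine le_of_mul_le_mul_right ?_ p1
      calc 3 * Real.exp (a⁻¹ / 2 * R) * Real.exp (a⁻¹ * Δ)
          = (12 * Real.exp (a⁻¹ * Δ)) * Real.exp (a⁻¹ / 2 * R) / 4 := by ring
        _ ≤ (Real.exp (a⁻¹ / 2 * R) * δ) * Real.exp (a⁻¹ / 2 * R) / 4 := by gcongr
        _ = δ * (Real.exp (a⁻¹ * (R - Δ)) / 4) * Real.exp (a⁻¹ * Δ) := by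
          linear_combination (-δ / 4) * e1
    obtain ⟨R, ⟨hR1, hR2⟩, hRl, hRz⟩ :=
      ((hs (a⁻¹ / 2) (by positivity)).and_eventually
        (hlarge.and (eventually_ge_atTop (|z.im| + Δ)))).exists
    set M := Real.exp (a⁻¹ / 2 * R) with hMdef
    have hM : 0 < M := Real.exp_pos _
    -- The margin `Δ` leaves room for the discs of radius `Δ` used by `neg_le`.
    set r := R - Δ with hr
    have hax : ∀ y : ℝ, |y| ≤ R → U (y * Complex.I) ≤ M := fun y hy =>
      (h.axis_le_max hy).trans (max_le hR1 hR2)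
    set K : Set ℂ := Icc 0 a ×ℂ Icc (-r) r with hK
    set V : Set ℂ := Ioo 0 a ×ℂ Ioo (-r) r with hV
    have hKc : IsCompact K := isCompact_Icc.reProdIm isCompact_Icc
    have hVo : IsOpen V := isOpen_Ioo.reProdIm isOpen_Ioo
    have hVK : V ⊆ K := fun w hw => ⟨Ioo_subset_Icc_self hw.1, Ioo_subset_Icc_self hw.2⟩
    have hharm : InnerProductSpace.HarmonicOnNhd
        (fun w => U (2 * a - starRingEnd ℂ w) - U w - δ * H w) K := by
      intro w hw
      have hw1 := hw.1
      simp only [mem_preimage, mem_Icc] at hw1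
      have m1 : w ∈ verticalStrip Δ := by
        simp only [verticalStrip, Set.mem_ofPred_eq, abs_lt]
        constructor <;> linarith
      have m2 : 2 * a - starRingEnd ℂ w ∈ verticalStrip Δ := by
        simp only [verticalStrip, Set.mem_ofPred_eq, abs_lt]
        simp
        constructor <;> linarith
      have hHh : InnerProductSpace.HarmonicAt H w := AnalyticAt.harmonicAt_re (by fun_prop)
      exact ((HarmonicAt.comp_const_sub_conj (h.harmonic _ m2)).sub (h.harmonic _ m1)).sub
        (hHh.const_smul (c := δ))
    have hbd : ∀ w ∈ K \ V, U (2 * a - starRingEnd ℂ w) - U w - δ * H w ≤ 0 := by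
      rintro w ⟨⟨hw1, hw2⟩, hwV⟩
      simp only [mem_preimage, mem_Icc] at hw1 hw2
      have hHw := mul_nonneg hδ.le (hHpos w hw1.1 hw1.2)
      have m2 : 2 * a - starRingEnd ℂ w ∈ verticalStrip Δ := by
        simp only [verticalStrip, Set.mem_ofPred_eq, abs_lt]
        simp
        constructor <;> linarith
      have hridge : U (2 * a - starRingEnd ℂ w) ≤ U (w.im * Complex.I) := by
        have := h.ridge _ m2
        simpa using this
      rcases hw1.1.eq_or_lt with e | hlt
      · have : w = w.im * Complex.I := by
          apply Complex.ext <;> simp [← e]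
        rw [← this] at hridge
        linarith
      rcases hw1.2.eq_or_lt with e | hlt2
      · have : 2 * a - starRingEnd ℂ w = w := by
          apply Complex.ext
          · simp [e]; ring
          · simp
        rw [this]; linarith
      have him : |w.im| = r := by
        refine le_antisymm (abs_le.2 hw2) ?_
        by_contra! hlt3
        exact hwV ⟨⟨hlt, hlt2⟩, abs_lt.1 hlt3⟩
      have hup : U (w.im * Complex.I) ≤ M := hax _ (by rw [him]; linarith)
      have hlo := h.neg_le (Y := w.im) (x := w.re) hM (h.axis_nonneg h0 h1 _) (fun y hy => by
        refine hax y ?_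
        have := abs_sub_abs_le_abs_sub y w.im
        linarith) (by rw [abs_of_pos hlt]; linarith)
      rw [add_comm, Complex.re_add_im] at hlo
      have hHl := mul_le_mul_of_nonneg_left (hHlow w hw1.1 hw1.2) hδ.le
      rw [him] at hHl
      linarith
    have := harmonic_nonpos_of_nonpos_off_open hKc hVo hVK hharm.continuousOn
      (hharm.mono hVK) hbd (z := z) ⟨⟨hz0, hza⟩, abs_le.1 (by linarith)⟩
    linarith
  have hlim : Tendsto (fun δ : ℝ => δ * H z) (𝓝[>] 0) (𝓝 0) := by
    have : Continuous fun δ : ℝ => δ * H z := by fun_prop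
    exact (this.tendsto' 0 0 (by simp)).mono_left nhdsWithin_le_nhds
  have := ge_of_tendsto hlim (by filter_upwards [self_mem_nhdsWithin] with δ hδ using key δ hδ)
  linarith

/-- The points at distance `t` to the right and left of `Re z = a` are mirror images, so
`reflect_le` compares them. -/
theorem deriv_nonpos (h : IsStripRidge U Δ) (h0 : U 0 = 0) (h1 : complexPartial U 0 = 0)
    (hs : SlowOnAxis U) {a y d : ℝ} (ha : 0 < a) (haΔ : a < Δ / 2)
    (hd : HasDerivAt (fun t : ℝ => U (a + y * Complex.I + t)) d 0) : d ≤ 0 := by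
  refine hd.nonpos_of_le_neg ha fun t ht hta => ?_
  have := h.reflect_le h0 h1 hs ha haΔ (z := a + y * Complex.I + (-t : ℝ)) (by simp; linarith)
    (by simp; linarith)
  convert this using 2
  simp; ring

theorem reflect (h : IsStripRidge U Δ) : IsStripRidge (fun z => U (0 - starRingEnd ℂ z)) Δ where
  pos := h.pos
  harmonic z hz := HarmonicAt.comp_const_sub_conj (h.harmonic _ (by
    simpa [verticalStrip] using hz))
  ridge z hz := by
    have := h.ridge (0 - starRingEnd ℂ z) (by simpa [verticalStrip] using hz)
    simpa using this

theorem complexPartial_reflect_zero (h : IsStripRidge U Δ) (h1 : complexPartial U 0 = 0) :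
    complexPartial (fun z => U (0 - starRingEnd ℂ z)) 0 = 0 := by
  apply Complex.ext
  · simpa using h.reflect.complexPartial_axis_re 0
  · have e1 := h.hasDerivAt_axis 0
    have e2 := h.reflect.hasDerivAt_axis 0
    simp only [map_mul, Complex.conj_ofReal, Complex.conj_I, mul_neg, zero_sub, neg_neg] at e2
    have := e1.unique e2
    simp only [Complex.ofReal_zero, zero_mul, h1] at this
    simpa using this.symm

/-- The horizontal derivative has the sign of `-Re z`. -/
theorem complexPartial_re_mul_re_nonpos (h : IsStripRidge U Δ) (h0 : U 0 = 0)
    (h1 : complexPartial U 0 = 0) (hs : SlowOnAxis U) {z : ℂ} (hz : |z.re| < Δ / 2) :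
    (complexPartial U z).re * z.re ≤ 0 := by
  have hΔ := h.pos
  have hzS : z ∈ verticalStrip Δ := by
    simp only [verticalStrip, Set.mem_ofPred_eq]; linarith
  have hd := HarmonicAt.hasDerivAt_line (f := U) (p := z) (w := 1) (t := 0)
    (by simpa using h.harmonic z hzS)
  simp only [mul_one, Complex.ofReal_zero, add_zero] at hd
  rcases lt_trichotomy z.re 0 with hneg | hz0 | hpos
  · have hd' := (HasDerivAt.comp (0 : ℝ) (h₂ := fun s : ℝ => U (z + s)) (by simpa using hd)
      (hasDerivAt_neg 0))
    have := h.reflect.deriv_nonpos (a := -z.re) (y := z.im) (d := (complexPartial U z).re * -1)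
      (by simpa using h0)
      (h.complexPartial_reflect_zero h1) (fun ε hε => by simpa using hs ε hε) (by linarith)
      (by linarith [neg_abs_le z.re]) (by
        refine hd'.congr_of_eventuallyEq (Eventually.of_forall fun t => ?_)
        refine congrArg U (Complex.ext ?_ ?_) <;> simp; ring)
    nlinarith
  · simp [hz0]
  · have := h.deriv_nonpos h0 h1 hs (a := z.re) (y := z.im) hpos (by linarith [le_abs_self z.re])
      (by simpa [Complex.re_add_im] using hd)
    nlinarith

end IsStripRidge

/-! ### Holomorphic functions whose real part has the sign of `Re z` -/

/-- Rogosinski's device: if `Re F` has the sign of `Re z` then `F(z) (ρ² + z²) / z` has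
nonnegative real part. This gives a bound for `F(z) - z` when `F(z) = z + O(z²)`. -/
theorem norm_sub_le_of_re_mul_re_nonneg {F : ℂ → ℂ} {ρ : ℝ} (hρ : 0 < ρ)
    (hF : AnalyticOnNhd ℂ F (Metric.closedBall 0 ρ)) (h0 : F 0 = 0) (h1 : deriv F 0 = 1)
    (hpos : ∀ z ∈ Metric.closedBall (0 : ℂ) ρ, 0 ≤ (F z).re * z.re) {z : ℂ}
    (hz : ‖z‖ ≤ 4 / 5 * ρ) : ‖F z - z‖ ≤ 30 * ‖z‖ ^ 2 / ρ := by
  set P : ℂ → ℂ := fun w => dslope F 0 w * (ρ ^ 2 + w ^ 2) with hP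
  have hmul : ∀ w, F w = w * dslope F 0 w := by
    intro w
    have := sub_smul_dslope F 0 w
    simpa [h0] using this.symm
  have hP0 : P 0 = (ρ : ℂ) ^ 2 := by simp [hP, h1]
  have hs : AnalyticOnNhd ℂ (dslope F 0) (Metric.closedBall 0 ρ) := by
    intro w hw
    rcases eq_or_ne w 0 with rfl | hne
    · obtain ⟨p, hp⟩ := hF 0 hw
      exact ⟨_, hp.has_fpower_series_dslope_fslope⟩
    · have hev : dslope F 0 =ᶠ[𝓝 w] fun v => F v / v := by
        filter_upwards [isOpen_ne.mem_nhds hne] with v hv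
        rw [hmul v, mul_div_cancel_left₀ _ hv]
      exact ((hF w hw).div analyticAt_id hne).congr hev.symm
  have hPa : AnalyticOnNhd ℂ P (Metric.closedBall 0 ρ) := fun w hw => (hs w hw).mul (by fun_prop)
  have hharm : InnerProductSpace.HarmonicOnNhd (fun w => (-P w).re) (Metric.closedBall 0 ρ) :=
    fun w hw => (hPa w hw).neg.harmonicAt_re
  have hPre : ∀ w ∈ Metric.closedBall (0 : ℂ) ρ, (-P w).re ≤ 0 := by
    intro w hw
    refine harmonic_nonpos_of_nonpos_off_open (isCompact_closedBall (0 : ℂ) ρ) Metric.isOpen_ball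
      Metric.ball_subset_closedBall hharm.continuousOn (hharm.mono Metric.ball_subset_closedBall)
      ?_ hw
    rintro v ⟨hv, hvb⟩
    have hvρ : ‖v‖ = ρ := by
      simp only [Metric.mem_closedBall, Metric.mem_ball, dist_zero_right, not_lt] at hv hvb
      exact le_antisymm hv hvb
    -- On `|v| = ρ` one has `ρ² = v * conj v`, so `P v = 2 * Re v * F v`, whose real part is
    -- nonnegative; the maximum principle carries this inside.
    have hcc : (ρ : ℂ) ^ 2 + v ^ 2 = v * ((2 * v.re : ℝ) : ℂ) := by
      rw [← hvρ, ← Complex.mul_conj', ← Complex.add_conj]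
      ring
    have : P v = F v * ((2 * v.re : ℝ) : ℂ) := by
      simp only [hP]
      rw [hcc, hmul v]; ring
    rw [this, Complex.neg_re, Complex.re_mul_ofReal]
    linarith [hpos v hv]
  set r := ‖z‖ with hr
  have hr0 : 0 ≤ r := norm_nonneg z
  have hzb : z ∈ Metric.ball (0 : ℂ) ρ := by
    simp only [Metric.mem_ball, dist_zero_right]; linarith
  have hbc := Complex.borelCaratheodory_zero (f := fun w => P 0 - P w) (M := ρ ^ 2)
    (by positivity)
    (fun w hw => (((hPa w (Metric.ball_subset_closedBall hw)).differentiableAt).const_sub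
      _).differentiableWithinAt)
    (fun w hw => by
      have := hPre w (Metric.ball_subset_closedBall hw)
      simp only [Complex.neg_re] at this
      have e : (P 0).re = ρ ^ 2 := by rw [hP0]; exact_mod_cast rfl
      simp only [Set.mem_ofPred_eq, Complex.sub_re, e]
      linarith) hρ hzb (by simp)
  -- Since `r ≤ 4ρ/5`, the denominator `ρ - r` is at least `ρ/5`; likewise `1 - (4/5)² = 9/25`
  -- below. The final constant is `(10 + 4/5) * 25/9 = 30`.
  have hPz : ‖P 0 - P z‖ ≤ 10 * ρ * r := by
    refine hbc.trans ?_
    rw [div_le_iff₀ (by linarith)]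
    have : 0 ≤ ρ * r := by positivity
    nlinarith
  have hden : 9 / 25 * ρ ^ 2 ≤ ‖(ρ : ℂ) ^ 2 + z ^ 2‖ := by
    have e1 : ‖(ρ : ℂ) ^ 2‖ = ρ ^ 2 := by simp
    have e2 := norm_sub_norm_le ((ρ : ℂ) ^ 2) (-z ^ 2)
    have e3 : ‖(-z ^ 2 : ℂ)‖ = r ^ 2 := by simp [hr]
    rw [e1, e3, sub_neg_eq_add] at e2
    nlinarith
  have hid : (F z - z) * ((ρ : ℂ) ^ 2 + z ^ 2) = z * (-(P 0 - P z) - z ^ 2) := by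
    rw [hP0]
    simp only [hP]
    rw [hmul z]; ring
  have hnorm : ‖F z - z‖ * (9 / 25 * ρ ^ 2) ≤ r * (10 * ρ * r + r ^ 2) := by
    calc ‖F z - z‖ * (9 / 25 * ρ ^ 2) ≤ ‖F z - z‖ * ‖(ρ : ℂ) ^ 2 + z ^ 2‖ := by gcongr
      _ = r * ‖-(P 0 - P z) - z ^ 2‖ := by rw [← norm_mul, hid, norm_mul]
      _ ≤ r * (‖-(P 0 - P z)‖ + ‖z ^ 2‖) := by gcongr; exact norm_sub_le _ _
      _ ≤ r * (10 * ρ * r + r ^ 2) := by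
        rw [norm_neg, norm_pow]; gcongr
  have hr2 : r * (10 * ρ * r + r ^ 2) ≤ 54 / 5 * ρ * r ^ 2 := by
    have : r * r ^ 2 ≤ 4 / 5 * ρ * r ^ 2 := by gcongr
    nlinarith
  rw [le_div_iff₀ hρ]
  have : ‖F z - z‖ * ρ * (9 / 25 * ρ) ≤ 30 * r ^ 2 * (9 / 25 * ρ) := by nlinarith
  exact le_of_mul_le_mul_right this (by positivity)

/-! ### Integration of the gradient estimate and conclusion -/

/-- The quadratic approximation of a harmonic ridge function of slow growth. -/
theorem IsStripRidge.abs_add_le {U : ℂ → ℝ} {Δ : ℝ} (h : IsStripRidge U Δ) (h0 : U 0 = 0)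
    (h1 : complexPartial U 0 = 0) (hs : SlowOnAxis U) (h2 : deriv (complexPartial U) 0 = -1)
    {z : ℂ} (hz : ‖z‖ ≤ Δ / 3) : |U z + (z ^ 2 / 2).re| ≤ 72 * ‖z‖ ^ 3 / Δ := by
  have hΔ := h.pos
  -- The radius `5Δ/12` is below `Δ/2`, where the sign condition holds, and `4/5` of it is `Δ/3`;
  -- then `30 * 12/5 = 72`.
  have hρ : 0 < 5 / 12 * Δ := by positivity
  have hstrip : ∀ w ∈ Metric.closedBall (0 : ℂ) (5 / 12 * Δ), |w.re| ≤ 5 / 12 * Δ := by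
    intro w hw
    exact (Complex.abs_re_le_norm w).trans (by simpa using hw)
  have hmem : ∀ w ∈ Metric.closedBall (0 : ℂ) (5 / 12 * Δ), w ∈ verticalStrip Δ := by
    intro w hw
    have := hstrip w hw
    simp only [verticalStrip, Set.mem_ofPred_eq]; linarith
  have hg : ∀ w : ℂ, ‖w‖ ≤ Δ / 3 →
      ‖complexPartial U w + w‖ ≤ 72 * ‖w‖ ^ 2 / Δ := by
    intro w hw
    have := norm_sub_le_of_re_mul_re_nonneg (F := fun v => -complexPartial U v) hρ
      (fun v hv => (HarmonicAt.analyticAt_complexPartial (h.harmonic v (hmem v hv))).neg)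
      (by simp [h1]) (by rw [deriv.fun_neg, h2, neg_neg]) (fun v hv => by
        have := h.complexPartial_re_mul_re_nonpos h0 h1 hs (z := v) (by linarith [hstrip v hv])
        simp only [Complex.neg_re]; linarith) (z := w) (by linarith)
    have e : -complexPartial U w - w = -(complexPartial U w + w) := by ring
    rw [e, norm_neg] at this
    refine this.trans_eq ?_
    field_simp
    ring
  have hball : ∀ t ∈ Icc (0 : ℝ) 1, ‖(t : ℂ) * z‖ ≤ ‖z‖ := by
    intro t ht
    rw [norm_mul, Complex.norm_real, Real.norm_of_nonneg ht.1]
    exact mul_le_of_le_one_left (norm_nonneg z) ht.2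
  set ψ : ℝ → ℝ := fun t => U (0 + t * z) + ((t * z) ^ 2 / 2 : ℂ).re with hψ
  have hd : ∀ t ∈ Icc (0 : ℝ) 1,
      HasDerivAt ψ ((complexPartial U (t * z) + t * z) * z).re t := by
    intro t ht
    have e1 := HarmonicAt.hasDerivAt_line (f := U) (p := 0) (w := z) (t := t)
      (h.harmonic _ (hmem _ (by
        have := hball t ht
        simp only [zero_add, Metric.mem_closedBall, dist_zero_right]
        linarith)))
    have e2 : HasDerivAt (fun s : ℝ => ((s : ℂ) * z) ^ 2 / 2) (t * z * z) t := by
      have := (((hasDerivAt_affine 0 z t).pow 2).div_const 2)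
      simp only [zero_add] at this
      refine this.congr_deriv ?_
      norm_num
      ring
    have e3 := Complex.reCLM.hasFDerivAt.comp_hasDerivAt t e2
    have := e1.add e3
    refine (this.congr_deriv ?_)
    simp [add_mul]
  have hbound := norm_image_sub_le_of_norm_deriv_le_segment_01' (f := ψ)
    (f' := fun t => ((complexPartial U (t * z) + t * z) * z).re) (C := 72 * ‖z‖ ^ 3 / Δ)
    (fun t ht => (hd t ht).hasDerivWithinAt) (by
      intro t ht
      have hb := hball t (Ico_subset_Icc_self ht)
      calc ‖((complexPartial U (t * z) + t * z) * z).re‖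
          ≤ ‖(complexPartial U (t * z) + t * z) * z‖ := Complex.abs_re_le_norm _
        _ ≤ (72 * ‖(t : ℂ) * z‖ ^ 2 / Δ) * ‖z‖ := by
          rw [norm_mul]; gcongr; exact hg _ (hb.trans hz)
        _ ≤ (72 * ‖z‖ ^ 2 / Δ) * ‖z‖ := by gcongr
        _ = 72 * ‖z‖ ^ 3 / Δ := by ring)
  simpa [hψ, h0] using hbound

theorem theorem1 :
    ∃ c₀ : ℝ, 0 < c₀ ∧
      ∀ (Δ : ℝ) (u : ℂ → EReal), 0 < Δ →
        IsSubharmonic u → IsRidge u → HasSlowGrowth u →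
        IsHarmonicOn u (verticalStrip Δ) →
        u 0 = 0 →
        deriv (fun x : ℝ => (u (x : ℂ)).toReal) 0 = 0 →
        deriv (fun y : ℝ => (u (y * Complex.I)).toReal) 0 = 0 →
        iteratedDeriv 2 (fun y : ℝ => (u (y * Complex.I)).toReal) 0 = 1 →
        ∀ z : ℂ, ‖z‖ ≤ Δ / 3 →
          |(u z).toReal + (z ^ 2 / 2).re| ≤ c₀ * ‖z‖ ^ 3 / Δ := by
  refine ⟨72, by norm_num, ?_⟩
  intro Δ u hΔ hsub hridge hgrow hharm hu0 _ hy hyy z hz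
  have h : IsStripRidge (fun z => (u z).toReal) Δ :=
    { pos := hΔ
      harmonic := hharm.2
      ridge := fun w hw => EReal.toReal_le_toReal (hridge w) (hharm.1 w hw).1 (hsub.ne_top _) }
  have hd : deriv (fun s : ℝ => (u (s * Complex.I)).toReal) =
      fun s : ℝ => -(complexPartial (fun z => (u z).toReal) (s * Complex.I)).im :=
    funext fun y => (h.hasDerivAt_axis y).deriv
  have h1 : complexPartial (fun z => (u z).toReal) 0 = 0 := by
    apply Complex.ext
    · simpa using h.complexPartial_axis_re 0
    · rw [hd] at hy
      simpa using hy
  have h2 : deriv (complexPartial fun z => (u z).toReal) 0 = -1 := by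
    apply Complex.ext
    · rw [iteratedDeriv_succ, iteratedDeriv_one, hd,
        (h.hasDerivAt_complexPartial_axis 0).deriv] at hyy
      simp only [Complex.ofReal_zero, zero_mul] at hyy
      simp only [Complex.neg_re, Complex.one_re]
      linarith
    · simpa using h.deriv_complexPartial_zero_im
  exact h.abs_add_le (by simp [hu0]) h1
    (fun ε hε => hgrow.frequently_le_exp (fun y => hsub.ne_top _) hε) h2 hz
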